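/- Let $(B,\|\cdot\|)$ be a separable real Banach space, let $1<r\le 2$ and $D>0$, and let $B$ be $(r,D)$-smooth. This means two things. First, there is an equivalent norm $\|\cdot\|'$ on $B$ with $$\sup_{t>0}\frac1{t^r}\sup\{\|x+ty\|'+\|x-ty\|'-2:\ \|x\|'=\|y\|'=1\}<\infty .$$ Second, $\mathbb E\big\|\sum_{i=1}^n Y_i\big\|^r\le D\sum_{i=1}^n\mathbb E\|Y_i\|^r$ for every $n\ge1$ and every $B$-valued martingale difference sequence $(Y_i,\mathcal F_i)_{i\ge1}$, that is, $Y_i$ is integrable and $\mathcal F_i$-measurable for $i\ge1$ and $\mathbb E[Y_i\mid\mathcal F_{i-1}]=0$ almost surely for $i\ge2$. Let $p>r$, and let $(X_i)_{i\ge1}$ be a sequence of independent centered $B$-valued random variables such that $$\sup_{i\ge1}\sup_{t>0}t^p\,\mathbb P(\|X_i\|>t)\le C$$ for some constant $C$. Put $S_k=\sum_{i=1}^kX_i$ and $p_2=(p-1)r/(r-1)$. Then $\sup_{i\ge1}(\mathbb E\|X_i\|^r)^{p_2/r}<\infty$, and for all $x>0$ and $n\ge1$ $$\mathbb P\Big(\max_{1\le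 k\le n}\|S_k\|>nx\Big)\le\Big(K_1\,x^{-p}C+K_2\,\sup_{i\ge1}\big(\mathbb E\|X_i\|^r\big)^{p_2/r}x^{-p_2}\Big)\frac1{n^{p-1}},$$ where $$K_1=\frac{2^{2p_2}}{2^{2p_2}-1}\,2^{1-r}\,2^{p+2pp_2/r}D^{p/r},\qquad K_2=\frac{2^{2p_2}}{2^{2p_2}-1}\,2^{1-r}\,2^{p_2+2p_2^2/r}D^{p_2/r}\Big(\frac{p_2}{p_2-r}\Big)^{p_2/r}$$ depend only on $p$, $r$ and $D$. Consequently, with $K(p,r,D)=\max\{K_1,K_2\}$, $$\mathbb P\Big(\max_{1\le k\le n}\|S_k\|>nx\Big)\le K(p,r,D)\Big(x^{-p}C+\sup_{i\ge1}\big(\mathbb E\|X_i\|^r\big)^{p_2/r}x^{-p_2}\Big)\frac1{n^{p-1}}$$ for all $x>0$ and $n\ge1$. In particular, for every $x>0$, $\mathbb P(\max_{1\le k\le n}\|S_k\|>nx)=O(n^{-(p-1)})$ as $n\to\infty$. -/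

import Mathlib

open MeasureTheory ProbabilityTheory Filter Set
open scoped ENNReal

universe u v

/-- A Banach space `B` is `r`-smooth (`1 < r ≤ 2`) if it carries an equivalent norm `N` with
`sup_{t > 0} t⁻ʳ sup { N (x + t y) + N (x - t y) - 2 : N x = N y = 1 } < ∞`. The two-sided
comparison with `‖·‖` makes the seminorm `N` a norm equivalent to `‖·‖`. -/
def IsRSmooth (B : Type v) [NormedAddCommGroup B] [NormedSpace ℝ B] (r : ℝ) : Prop :=
  1 < r ∧ r ≤ 2 ∧
    ∃ N : Seminorm ℝ B,
      (∃ c₁ c₂ : ℝ, 0 < c₁ ∧ 0 < c₂ ∧ ∀ x : B, c₁ * ‖x‖ ≤ N x ∧ N x ≤ c₂ * ‖x‖) ∧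
      ∃ M : ℝ, ∀ t : ℝ, 0 < t → ∀ x y : B, N x = 1 → N y = 1 →
        (N (x + t • y) + N (x - t • y) - 2) / t ^ r ≤ M

/-- `X` is a martingale difference sequence for the filtration `ℱ`. Sequences are indexed from
`0`, so `X i` and `ℱ i` are the usual `X_{i+1}` and `ℱ_{i+1}`; the first term is only required to
be integrable and `ℱ 0`-measurable. -/
structure IsMartingaleDifference {Ω : Type u} {m : MeasurableSpace Ω} {B : Type v}
    [NormedAddCommGroup B] [NormedSpace ℝ B] [CompleteSpace B]
    (X : ℕ → Ω → B) (ℱ : Filtration ℕ m) (μ : Measure Ω) : Prop where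
  stronglyMeasurable : ∀ i, StronglyMeasurable[ℱ i] (X i)
  integrable : ∀ i, Integrable (X i) μ
  condExp_eq_zero : ∀ i, μ[X (i + 1) | ℱ i] =ᵐ[μ] 0

/-- `B` is `(r, D)`-smooth: it is `r`-smooth, and `E ‖X₁ + ⋯ + Xₙ‖ʳ ≤ D ∑ E ‖Xᵢ‖ʳ` for all
`B`-valued martingale difference sequences and all `n`. The expectations take values in `[0, ∞]`,
since the terms of the sequence are only assumed integrable. -/
def IsRDSmooth (B : Type v) [NormedAddCommGroup B] [NormedSpace ℝ B] [CompleteSpace B]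
    (r D : ℝ) : Prop :=
  IsRSmooth B r ∧ 0 < D ∧
    ∀ (Ω : Type u) (m : MeasurableSpace Ω) (μ : Measure Ω) (_ : IsProbabilityMeasure μ)
      (ℱ : Filtration ℕ m) (X : ℕ → Ω → B), IsMartingaleDifference X ℱ μ →
      ∀ n : ℕ, ∫⁻ ω, ‖∑ i ∈ Finset.range n, X i ω‖ₑ ^ r ∂μ ≤
        ENNReal.ofReal D * ∑ i ∈ Finset.range n, ∫⁻ ω, ‖X i ω‖ₑ ^ r ∂μ

/-- `max_{1 ≤ k ≤ n} ‖S_k‖` for `n ≥ 1`, where `S_k` is the sum of the first `k` terms of `X`. -/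
noncomputable def maxPartialSum {Ω : Type u} {B : Type v} [NormedAddCommGroup B]
    (X : ℕ → Ω → B) (n : ℕ) (ω : Ω) : ℝ :=
  ⨆ k : Fin n, ‖∑ i ∈ Finset.range (k.val + 1), X i ω‖

/-- The exponent `p₂ = (p - 1) r / (r - 1)`. -/
noncomputable def secondExponent (p r : ℝ) : ℝ := (p - 1) * r / (r - 1)

/-- The constant of the term `C x⁻ᵖ`, with `p₂ = (p - 1) r / (r - 1)`:
`2^{2p₂} / (2^{2p₂} - 1) * 2^{1-r} * 2^{p + 2 p p₂ / r} * D^{p/r}`. -/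
noncomputable def constTail (p r D : ℝ) : ℝ :=
  let p₂ := secondExponent p r
  (2 : ℝ) ^ (2 * p₂) / ((2 : ℝ) ^ (2 * p₂) - 1) * (2 : ℝ) ^ (1 - r) *
    (2 : ℝ) ^ (p + 2 * p * p₂ / r) * D ^ (p / r)

/-- The constant of the moment term, with `p₂ = (p - 1) r / (r - 1)`:
`2^{2p₂} / (2^{2p₂} - 1) * 2^{1-r} * 2^{p₂ + 2 p₂² / r} * D^{p₂/r} * (p₂ / (p₂ - r))^{p₂/r}`. -/
noncomputable def constMoment (p r D : ℝ) : ℝ :=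
  let p₂ := secondExponent p r
  (2 : ℝ) ^ (2 * p₂) / ((2 : ℝ) ^ (2 * p₂) - 1) * (2 : ℝ) ^ (1 - r) *
    (2 : ℝ) ^ (p₂ + 2 * p₂ ^ 2 / r) * D ^ (p₂ / r) * (p₂ / (p₂ - r)) ^ (p₂ / r)

/-! Write `f y` for the probability that some `‖S_k‖` with `k ≤ n` exceeds `y`, and `w` for the
supremum of the `r`-th moments. If the path passes `2l` and no increment exceeds `l/2`, then the
increments between the first passages of `l` and `2l` sum to a vector of norm above `l/2`. These
increments form a martingale difference sequence, and by independence their `r`-th moments carry the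
factor `f l`. Markov's inequality and `(r, D)`-smoothness then give the good-`λ` inequality of
`good_lambda`: `f (2l) ≤ D n w (l/2)⁻ʳ f l + n C (l/2)⁻ᵖ`.

`le_of_good_lambda` iterates it over halvings of `y`. When the moment term of the claimed bound is
at least `1`, the bound is trivial. Otherwise the coefficient of `f (y/2)` is so small that the
bound at `y/2` implies the bound at `y` (`contraction_of_constMoment_lt_one`). At `y = n x` both
terms scale as `n^{-(p-1)}`; for the moment term this is what determines `p₂`. -/

/-! ### Exponents and numerical bounds on the constants. -/

lemma secondExponent_eq {p r : ℝ} (hr : 1 < r) :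
    p = 1 + secondExponent p r / r * (r - 1) := by
  have h1 : r - 1 ≠ 0 := by linarith
  have h2 : r ≠ 0 := by linarith
  unfold secondExponent
  field_simp
  ring

lemma one_lt_secondExponent_div {p r : ℝ} (hr : 1 < r) (hp : r < p) :
    1 < secondExponent p r / r := by
  have h := secondExponent_eq (p := p) hr
  have h3 : 0 < r - 1 := by linarith
  by_contra hc
  push Not at hc
  nlinarith

/-- Applied with `s = p₂/r - 1`, where the right side is the factor `p₂/(p₂ - r)` of the moment
constant. -/
lemma two_rpow_sub_mul_le {k s : ℝ} (hk : k = 1 ∨ k = 2) (hs : 0 < s) :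
    (2 : ℝ) ^ (k - k * s) ≤ (1 + s) / s := by
  have h4 : 1 + s ≤ (4 : ℝ) ^ s := by
    have h := Real.add_one_le_exp (s * Real.log 4)
    have hl : 1 ≤ Real.log 4 := by
      rw [Real.le_log_iff_exp_le (by norm_num)]
      linarith [Real.exp_one_lt_d9]
    rw [Real.rpow_def_of_pos (by norm_num), mul_comm (Real.log 4)]
    nlinarith
  rcases hk with rfl | rfl
  · rw [one_mul, Real.rpow_sub two_pos, Real.rpow_one, div_le_div_iff₀ (by positivity) hs]
    rcases le_total s 1 with h | h
    · have : (1 : ℝ) ≤ 2 ^ s := Real.one_le_rpow (by norm_num) hs.le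
      nlinarith
    · have : (2 : ℝ) ^ (1 : ℝ) ≤ 2 ^ s := Real.rpow_le_rpow_of_exponent_le (by norm_num) h
      rw [Real.rpow_one] at this
      nlinarith
  · rw [Real.rpow_sub two_pos, Real.rpow_mul two_pos.le]
    norm_num
    rw [div_le_div_iff₀ (by positivity) hs]
    nlinarith [sq_nonneg (1 - s)]

lemma one_le_geometric_factor {q : ℝ} (hq : 0 < q) :
    1 ≤ (2 : ℝ) ^ (2 * q) / ((2 : ℝ) ^ (2 * q) - 1) := by
  have : (1 : ℝ) < 2 ^ (2 * q) := Real.one_lt_rpow (by norm_num) (by linarith)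
  rw [one_le_div (by linarith)]
  linarith

/-- Ensures that the additive term of the good-`λ` inequality uses at most half of the tail term;
the other half is left for the recursive contribution. -/
lemma two_mul_four_rpow_le_constTail {p r D : ℝ} (hr : 1 < r) (hp : r < p) (hD : 1 ≤ D) :
    2 * (4 : ℝ) ^ p ≤ constTail p r D := by
  have hm := one_lt_secondExponent_div hr hp
  have hq : 0 < secondExponent p r := by
    by_contra hc
    have : secondExponent p r / r ≤ 0 := div_nonpos_of_nonpos_of_nonneg (by linarith) (by linarith)
    linarith
  have h1 := one_le_geometric_factor hq
  have h2 : (1 : ℝ) ≤ D ^ (p / r) := Real.one_le_rpow hD (div_nonneg (by linarith) (by linarith))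
  have h3 : 2 * (4 : ℝ) ^ p ≤
      (2 : ℝ) ^ (1 - r) * (2 : ℝ) ^ (p + 2 * p * secondExponent p r / r) := by
    rw [← Real.rpow_add two_pos, show (4 : ℝ) = 2 ^ (2 : ℝ) by norm_num,
      ← Real.rpow_mul two_pos.le]
    nth_rewrite 1 [← Real.rpow_one 2]
    rw [← Real.rpow_add two_pos]
    apply Real.rpow_le_rpow_of_exponent_le (by norm_num)
    rw [mul_div_assoc]
    nlinarith
  unfold constTail
  simp only
  calc 2 * (4 : ℝ) ^ p = 1 * (2 * (4 : ℝ) ^ p) * 1 := by ring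
    _ ≤ _ := by
      rw [mul_assoc (_ / _)]
      gcongr

/-- Apart from the factor `2^{2p₂}/(2^{2p₂} - 1) ≥ 1`, the moment constant is an exact power of
order `p₂/r`, so a smallness condition on the moment term can be turned into one on `W y⁻ʳ` by
taking roots. -/
lemma rpow_le_constMoment {p r D : ℝ} (hr : 1 < r) (hp : r < p) (hD : 1 ≤ D) :
    (D * 2 ^ ((1 - r) / (secondExponent p r / r) + r + 2 * secondExponent p r) *
      ((secondExponent p r / r) / (secondExponent p r / r - 1))) ^ (secondExponent p r / r) ≤
      constMoment p r D := by
  have hm := one_lt_secondExponent_div hr hp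
  set m := secondExponent p r / r with hmdef
  have hr0 : r ≠ 0 := by linarith
  have hqm : secondExponent p r = m * r := by rw [hmdef]; field_simp
  have hq : 0 < secondExponent p r := by rw [hqm]; nlinarith
  have h1 := one_le_geometric_factor hq
  have hm1 : 0 < m - 1 := by linarith
  have hm0 : 0 < m := by linarith
  unfold constMoment
  simp only
  rw [← hmdef]
  have e1 : secondExponent p r / (secondExponent p r - r) = m / (m - 1) := by
    rw [hqm, show m * r - r = (m - 1) * r by ring, mul_div_mul_right _ _ hr0]
  rw [e1, Real.mul_rpow (by positivity) (by positivity), Real.mul_rpow (by positivity)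
    (by positivity), ← Real.rpow_mul two_pos.le]
  have e2 : ((1 - r) / m + r + 2 * secondExponent p r) * m =
      (1 - r) + (secondExponent p r + 2 * secondExponent p r ^ 2 / r) := by
    rw [hqm]; field_simp; ring
  rw [e2, Real.rpow_add two_pos]
  set E := (2 : ℝ) ^ (1 - r) * 2 ^ (secondExponent p r + 2 * secondExponent p r ^ 2 / r)
  rw [mul_assoc (_ / _)]
  calc D ^ m * E * (m / (m - 1)) ^ m = 1 * E * D ^ m * (m / (m - 1)) ^ m := by ring
    _ ≤ _ := by gcongr

/-! ### Iteration of the good-`λ` inequality. -/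

/-- If the moment term of the deviation bound is less than one, then the contraction factor of
the good-`λ` inequality is small. -/
lemma contraction_of_constMoment_lt_one {p r D W y : ℝ} (hr : 1 < r) (hr2 : r ≤ 2) (hp : r < p)
    (hD : 1 ≤ D) (hW : 0 ≤ W) (hy : 0 < y)
    (h : constMoment p r D * (W ^ (secondExponent p r / r) * y ^ (-secondExponent p r)) < 1) :
    D * W * (y / 4) ^ (-r) * 2 ^ p ≤ 1 / 2 ∧
      D * W * (y / 4) ^ (-r) * 2 ^ secondExponent p r ≤ 1 := by
  have hm := one_lt_secondExponent_div hr hp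
  have hK := rpow_le_constMoment hr hp hD
  have hpm := secondExponent_eq (p := p) hr
  set m := secondExponent p r / r with hmdef
  have hr0 : r ≠ 0 := by linarith
  have hqm : secondExponent p r = m * r := by rw [hmdef]; field_simp
  rw [hqm] at h hK ⊢
  have hm1 : 0 < m - 1 := by linarith
  have hm0 : 0 < m := by linarith
  set e := (1 - r) / m + r + 2 * (m * r) with he
  have h1 : (D * 2 ^ e * (m / (m - 1)) * (W * y ^ (-r))) ^ m < 1 := by
    refine lt_of_le_of_lt ?_ h
    rw [Real.mul_rpow (by positivity) (by positivity), Real.mul_rpow hW (by positivity),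
      ← Real.rpow_mul hy.le, show -r * m = -(m * r) by ring]
    gcongr
  have h2 : D * 2 ^ e * (m / (m - 1)) * (W * y ^ (-r)) < 1 := by
    by_contra hc
    push Not at hc
    exact absurd (Real.one_le_rpow hc hm0.le) (not_le.mpr h1)
  have hy4 : (y / 4) ^ (-r) = y ^ (-r) * 2 ^ (2 * r) := by
    rw [Real.div_rpow hy.le (by norm_num), Real.rpow_neg (by norm_num : (0 : ℝ) ≤ 4),
      Real.rpow_mul two_pos.le]
    norm_num
  have hrm : (r - 1) / m ≤ 1 := by
    rw [div_le_one hm0]; linarith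
  have hneg : (1 - r) / m = -((r - 1) / m) := by rw [← neg_div]; ring_nf
  -- The excess power of two over `2 ^ e` is absorbed by the factor `m / (m - 1)`.
  have key : ∀ k a : ℝ, (k = 1 ∨ k = 2) → 2 * r + a - e ≤ k - k * (m - 1) →
      D * W * (y / 4) ^ (-r) * 2 ^ a ≤ 1 := by
    intro k a hk ha
    have h3 : (2 : ℝ) ^ (2 * r + a - e) ≤ m / (m - 1) := by
      refine (Real.rpow_le_rpow_of_exponent_le (by norm_num) ha).trans ?_
      refine (two_rpow_sub_mul_le hk hm1).trans_eq ?_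
      ring_nf
    have h4 : (2 : ℝ) ^ (2 * r) * 2 ^ a = 2 ^ e * 2 ^ (2 * r + a - e) := by
      rw [← Real.rpow_add two_pos, ← Real.rpow_add two_pos]; ring_nf
    calc D * W * (y / 4) ^ (-r) * 2 ^ a
        = D * W * y ^ (-r) * (2 ^ (2 * r) * 2 ^ a) := by rw [hy4]; ring
      _ = D * 2 ^ e * 2 ^ (2 * r + a - e) * (W * y ^ (-r)) := by rw [h4]; ring
      _ ≤ D * 2 ^ e * (m / (m - 1)) * (W * y ^ (-r)) := by gcongr
      _ ≤ 1 := h2.le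
  constructor
  -- The exponent `p + 1` in place of `p` produces the bound `1/2`.
  · have := key 2 (p + 1) (Or.inr rfl) (by rw [he, hneg, hpm]; nlinarith)
    rw [Real.rpow_add two_pos, Real.rpow_one] at this
    linarith
  · exact key 1 _ (Or.inl rfl) (by rw [he, hneg]; nlinarith)

/-- A function with values in `[0, 1]` that satisfies a good-`λ` inequality obeys the
deviation bound. -/
lemma le_of_good_lambda {p r D W A : ℝ} (hr : 1 < r) (hr2 : r ≤ 2) (hp : r < p)
    (hD : 1 ≤ D) (hW : 0 ≤ W) (hA : 0 ≤ A) {f : ℝ → ℝ} (hf1 : ∀ y, f y ≤ 1)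
    (hf : ∀ y, 0 < y → f y ≤ D * W * (y / 4) ^ (-r) * f (y / 2) + A * (y / 4) ^ (-p))
    {y : ℝ} (hy : 0 < y) :
    f y ≤ constTail p r D * (A * y ^ (-p)) +
      constMoment p r D * (W ^ (secondExponent p r / r) * y ^ (-secondExponent p r)) := by
  have hm := one_lt_secondExponent_div hr hp
  have hK1 := two_mul_four_rpow_le_constTail hr hp hD
  have hK10 : 0 < constTail p r D := lt_of_lt_of_le (by positivity) hK1
  have hK20 : 0 < constMoment p r D := by
    refine lt_of_lt_of_le ?_ (rpow_le_constMoment hr hp hD)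
    have : 0 < secondExponent p r / r - 1 := by linarith
    positivity
  have hq : 0 < secondExponent p r := by
    by_contra hc
    have : secondExponent p r / r ≤ 0 := div_nonpos_of_nonpos_of_nonneg (by linarith) (by linarith)
    linarith
  set q := secondExponent p r with hqdef
  set K₁ := constTail p r D
  set K₂ := constMoment p r D
  have h4 : ∀ z : ℝ, 0 < z → A * (z / 4) ^ (-p) ≤ K₁ * (A * z ^ (-p)) / 2 := by
    intro z hz
    have : (z / 4) ^ (-p) = z ^ (-p) * 4 ^ p := by
      rw [Real.div_rpow hz.le (by norm_num), Real.rpow_neg (by norm_num : (0 : ℝ) ≤ 4),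
        div_inv_eq_mul]
    rw [this]
    have h0 : 0 ≤ A * z ^ (-p) := by positivity
    nlinarith
  -- For `W = 0` the moment term never reaches `1`, but the good-`λ` inequality has no recursive
  -- term either.
  rcases hW.eq_or_lt with hW0 | hW0
  · have h1 := hf y hy
    have h2 := h4 y hy
    have h3 : 0 ≤ K₁ * (A * y ^ (-p)) := by positivity
    rw [← hW0] at h1 ⊢
    rw [Real.zero_rpow (by linarith)]
    simp only [mul_zero, zero_mul, zero_add, add_zero] at h1 ⊢
    linarith
  have step : ∀ z, 0 < z →
      f (z / 2) ≤ K₁ * (A * (z / 2) ^ (-p)) + K₂ * (W ^ (q / r) * (z / 2) ^ (-q)) →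
      f z ≤ K₁ * (A * z ^ (-p)) + K₂ * (W ^ (q / r) * z ^ (-q)) := by
    intro z hz ih
    have hp0 : 0 ≤ K₁ * (A * z ^ (-p)) := by positivity
    have hq0 : 0 ≤ K₂ * (W ^ (q / r) * z ^ (-q)) := by positivity
    rcases lt_or_ge (K₂ * (W ^ (q / r) * z ^ (-q))) 1 with hlt | hge
    · obtain ⟨c1, c2⟩ := contraction_of_constMoment_lt_one hr hr2 hp hD hW hz hlt
      rw [← hqdef] at c2
      have hhalf : ∀ s : ℝ, (z / 2) ^ (-s) = z ^ (-s) * 2 ^ s := fun s => by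
        rw [Real.div_rpow hz.le (by norm_num), Real.rpow_neg (by norm_num : (0 : ℝ) ≤ 2),
          div_inv_eq_mul]
      rw [hhalf, hhalf] at ih
      have hu : 0 ≤ D * W * (z / 4) ^ (-r) := by positivity
      have h1 := hf z hz
      have h2 := h4 z hz
      have h3 := mul_le_mul_of_nonneg_left ih hu
      have h5 := mul_le_mul_of_nonneg_right c1 hp0
      have h6 := mul_le_mul_of_nonneg_right c2 hq0
      nlinarith
    · linarith [hf1 z]
  -- Each halving multiplies the moment term by `2 ^ q > 1`, so the trivial regime is reached after
  -- finitely many.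
  have base : ∃ N : ℕ, 1 ≤ K₂ * (W ^ (q / r) * (y / 2 ^ N) ^ (-q)) := by
    have ht : Tendsto (fun N : ℕ => K₂ * (W ^ (q / r) * y ^ (-q)) * ((2 : ℝ) ^ q) ^ N)
        atTop atTop :=
      (tendsto_pow_atTop_atTop_of_one_lt (Real.one_lt_rpow (by norm_num) hq)).const_mul_atTop
        (by positivity)
    obtain ⟨N, hN⟩ := (ht.eventually_ge_atTop 1).exists
    refine ⟨N, hN.trans_eq ?_⟩
    rw [Real.div_rpow hy.le (by positivity), Real.rpow_neg (by positivity : (0 : ℝ) ≤ 2 ^ N),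
      div_inv_eq_mul, ← Real.rpow_natCast, ← Real.rpow_natCast, ← Real.rpow_mul two_pos.le,
      ← Real.rpow_mul two_pos.le, mul_comm q]
    ring
  obtain ⟨N, hN⟩ := base
  clear_value K₁ K₂ q
  induction N generalizing y with
  | zero =>
    have h3 : 0 ≤ K₁ * (A * y ^ (-p)) := by positivity
    simp only [pow_zero, div_one] at hN
    linarith [hf1 y]
  | succ N ih =>
    refine step y hy (ih (half_pos hy) ?_)
    rw [div_div, ← pow_succ']
    exact hN

/-! ### Lower bound on the smoothness constant. -/

lemma IsRDSmooth.one_le {B : Type v} [NormedAddCommGroup B] [NormedSpace ℝ B] [CompleteSpace B]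
    [Nontrivial B] {r D : ℝ} (hB : IsRDSmooth.{u, v} B r D) : 1 ≤ D := by
  obtain ⟨b, hb⟩ := exists_ne (0 : B)
  obtain ⟨⟨hr, -, -⟩, hD, h⟩ := hB
  let : MeasurableSpace PUnit.{u + 1} := ⊤
  -- The first term of a martingale difference sequence need not be centered, so a nonzero constant
  -- is allowed there; `n = 1` then forces `1 ≤ D`.
  have hmd : IsMartingaleDifference (m := ⊤) (fun i _ => if i = 0 then b else (0 : B))
      (⊤ : Filtration ℕ (⊤ : MeasurableSpace PUnit.{u + 1})) (Measure.dirac PUnit.unit) := by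
    refine ⟨fun i => stronglyMeasurable_const, fun i => integrable_const _, fun i => ?_⟩
    simp only [Nat.add_eq_zero_iff, one_ne_zero, and_false, if_false]
    exact (condExp_zero (E := B)).eventuallyEq
  have h1 := h PUnit ⊤ (Measure.dirac PUnit.unit) inferInstance _ _ hmd 1
  simp only [Finset.range_one, Finset.sum_singleton, if_true, lintegral_const, measure_univ,
    mul_one] at h1
  have hb0 : ‖b‖ₑ ^ r ≠ 0 := by
    simp only [ne_eq, ENNReal.rpow_eq_zero_iff, enorm_eq_zero, hb, false_and, enorm_ne_top,
      or_false, not_false_eq_true]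
  have hbt : ‖b‖ₑ ^ r ≠ ∞ := ENNReal.rpow_ne_top_of_nonneg (by linarith) enorm_ne_top
  have h2 : 1 ≤ ENNReal.ofReal D := by
    by_contra hc
    push Not at hc
    have := ENNReal.mul_lt_mul_left hb0 hbt hc
    rw [one_mul] at this
    exact absurd h1 (not_le.mpr this)
  simpa using h2

/-! ### Pathwise crossing of the levels `l` and `2 l`. -/

section Deterministic

variable {B : Type v} [NormedAddCommGroup B]

/-- The increment `x i` counts when the path of partial sums has already exceeded the level `l`
but has not exceeded `2 l` before the `i`-th step. -/
def IsBetweenLevels (x : ℕ → B) (l : ℝ) (i : ℕ) : Prop :=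
  (∃ k ≤ i, l < ‖∑ j ∈ Finset.range k, x j‖) ∧ ∀ k ≤ i, ‖∑ j ∈ Finset.range k, x j‖ ≤ 2 * l

open Classical in
-- With `T` and `U` the first passages above `l` and `2 l`, the selected increments telescope to `S
-- U - S T`. The overshoot at `T` is at most one increment, so `‖S T‖ ≤ 3l/2` while `‖S U‖ > 2l`.
lemma lt_norm_sum_betweenLevels {x : ℕ → B} {l : ℝ} (hl : 0 < l) {n : ℕ}
    (hx : ∀ i < n, ‖x i‖ ≤ l / 2) (hs : ∃ k ≤ n, 2 * l < ‖∑ j ∈ Finset.range k, x j‖) :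
    l / 2 < ‖∑ i ∈ Finset.range n, if IsBetweenLevels x l i then x i else 0‖ := by
  set S : ℕ → B := fun k => ∑ j ∈ Finset.range k, x j with hS
  have hex2 : ∃ k, 2 * l < ‖S k‖ := let ⟨k, _, h⟩ := hs; ⟨k, h⟩
  have hex1 : ∃ k, l < ‖S k‖ := let ⟨k, _, h⟩ := hs; ⟨k, by linarith⟩
  set U := Nat.find hex2 with hU
  set T := Nat.find hex1 with hT
  have hUs : 2 * l < ‖S U‖ := Nat.find_spec hex2
  have hTs : l < ‖S T‖ := Nat.find_spec hex1
  have hUn : U ≤ n := let ⟨k, hk, h⟩ := hs; (Nat.find_min' hex2 h).trans hk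
  have hTU : T ≤ U := Nat.find_min' hex1 (by linarith)
  have hiff : ∀ i, IsBetweenLevels x l i ↔ T ≤ i ∧ i < U := by
    intro i
    constructor
    · rintro ⟨⟨k, hk, h⟩, h2⟩
      refine ⟨(Nat.find_min' hex1 h).trans hk, ?_⟩
      by_contra hc
      exact absurd (h2 U (not_lt.mp hc)) (not_le.mpr hUs)
    · rintro ⟨h1, h2⟩
      exact ⟨⟨T, h1, hTs⟩, fun k hk => not_lt.mp (Nat.find_min hex2 (hk.trans_lt h2))⟩
  have hsum : (∑ i ∈ Finset.range n, if IsBetweenLevels x l i then x i else 0) = S U - S T := by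
    rw [← Finset.sum_filter, hS, ← Finset.sum_Ico_eq_sub _ hTU]
    congr 1
    ext i
    simp only [Finset.mem_filter, Finset.mem_range, Finset.mem_Ico, hiff]
    omega
  have hTle : ‖S T‖ ≤ l + l / 2 := by
    rcases hT0 : T with _ | t
    · rw [hT0] at hTs
      simp only [hS, Finset.range_zero, Finset.sum_empty, norm_zero] at hTs ⊢
      linarith
    · have h1 : ‖S t‖ ≤ l := not_lt.mp (Nat.find_min hex1 (show t < T by omega))
      have h2 : S (t + 1) = S t + x t := Finset.sum_range_succ _ _
      rw [h2]
      exact (norm_add_le _ _).trans (add_le_add h1 (hx t (by omega)))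
  rw [hsum]
  have := norm_sub_norm_le (S U) (S T)
  linarith

lemma lt_maxPartialSum_iff {Ω : Type u} (X : ℕ → Ω → B) {n : ℕ} (hn : 1 ≤ n) {y : ℝ}
    (hy : 0 ≤ y) (ω : Ω) :
    y < maxPartialSum X n ω ↔ ∃ k ≤ n, y < ‖∑ i ∈ Finset.range k, X i ω‖ := by
  unfold maxPartialSum
  have : Nonempty (Fin n) := ⟨⟨0, hn⟩⟩
  rw [lt_ciSup_iff (Set.finite_range _).bddAbove]
  constructor
  · rintro ⟨k, hk⟩
    exact ⟨k + 1, k.2, hk⟩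
  · rintro ⟨k, hk, h⟩
    -- The empty sum `k = 0` is absent from the maximum; it cannot exceed `y ≥ 0`.
    rcases k with _ | k
    · simp only [Finset.range_zero, Finset.sum_empty, norm_zero] at h
      linarith
    · exact ⟨⟨k, hk⟩, h⟩

end Deterministic

/-! ### Strong moments from weak moments. -/

section Probability

variable {B : Type v} [NormedAddCommGroup B] [MeasurableSpace B] [BorelSpace B]
  {Ω : Type u} {mΩ : MeasurableSpace Ω} {μ : Measure Ω}

/-- A weak moment bound of order `p` controls the strong moments of every order `r < p`. -/
lemma lintegral_enorm_rpow_le_of_tail [IsProbabilityMeasure μ] {r p C : ℝ} (hr : 1 < r)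
    (hp : r < p) {Y : Ω → B} (hY : Measurable Y)
    (htail : ∀ t : ℝ, 0 < t → t ^ p * μ.real {ω | t < ‖Y ω‖} ≤ C) :
    ∫⁻ ω, ‖Y ω‖ₑ ^ r ∂μ ≤ ENNReal.ofReal (1 + r * C / (p - r)) := by
  have hC : 0 ≤ C := le_trans (by positivity) (htail 1 one_pos)
  have hpr : 0 < p - r := by linarith
  have h1 : ∫⁻ ω, ‖Y ω‖ₑ ^ r ∂μ = ∫⁻ ω, ENNReal.ofReal (‖Y ω‖ ^ r) ∂μ := by
    refine lintegral_congr fun ω => ?_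
    rw [← ofReal_norm, ENNReal.ofReal_rpow_of_nonneg (norm_nonneg _) (by linarith)]
  rw [h1, lintegral_rpow_eq_lintegral_meas_lt_mul μ (Eventually.of_forall fun _ => norm_nonneg _)
    hY.norm.aemeasurable (by linarith : 0 < r)]
  -- In the layer-cake integral the probability is bounded by `1` up to `t = 1` and by `C t⁻ᵖ`
  -- beyond; the second part converges because `r < p`.
  have hsplit : Ioi (0 : ℝ) = Ioc 0 1 ∪ Ioi 1 := (Ioc_union_Ioi_eq_Ioi zero_le_one).symm
  have hA : ∫⁻ t in Ioc (0 : ℝ) 1, μ {ω | t < ‖Y ω‖} * ENNReal.ofReal (t ^ (r - 1)) ≤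
      ENNReal.ofReal (1 / r) := by
    have hi : IntegrableOn (fun t : ℝ => t ^ (r - 1)) (Ioc 0 1) :=
      (intervalIntegrable_iff_integrableOn_Ioc_of_le zero_le_one).mp
        (intervalIntegral.intervalIntegrable_rpow' (by linarith))
    have hv : ∫ t in Ioc (0 : ℝ) 1, t ^ (r - 1) = 1 / r := by
      rw [← intervalIntegral.integral_of_le zero_le_one, integral_rpow (Or.inl (by linarith))]
      simp [Real.zero_rpow (show r ≠ 0 by linarith)]
    rw [← hv, ofReal_integral_eq_lintegral_ofReal hi
      ((ae_restrict_iff' measurableSet_Ioc).mpr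
        (Eventually.of_forall fun t ht => Real.rpow_nonneg ht.1.le _))]
    exact lintegral_mono fun t => mul_le_of_le_one_left zero_le prob_le_one
  have hB : ∫⁻ t in Ioi (1 : ℝ), μ {ω | t < ‖Y ω‖} * ENNReal.ofReal (t ^ (r - 1)) ≤
      ENNReal.ofReal (C / (p - r)) := by
    have hi : IntegrableOn (fun t : ℝ => C * t ^ (r - 1 - p)) (Ioi 1) :=
      (integrableOn_Ioi_rpow_of_lt (by linarith) one_pos).const_mul _
    have hv : ∫ t in Ioi (1 : ℝ), C * t ^ (r - 1 - p) = C / (p - r) := by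
      rw [integral_const_mul, integral_Ioi_rpow_of_lt (by linarith) one_pos, Real.one_rpow,
        show r - 1 - p + 1 = -(p - r) by ring, neg_div_neg_eq]
      ring
    rw [← hv, ofReal_integral_eq_lintegral_ofReal hi
      ((ae_restrict_iff' measurableSet_Ioi).mpr (Eventually.of_forall fun t ht =>
        mul_nonneg hC (Real.rpow_nonneg (zero_le_one.trans (le_of_lt ht)) _)))]
    refine setLIntegral_mono' measurableSet_Ioi fun t ht => ?_
    have ht0 : (0 : ℝ) < t := one_pos.trans ht
    rw [← ofReal_measureReal, ← ENNReal.ofReal_mul measureReal_nonneg]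
    refine ENNReal.ofReal_le_ofReal ?_
    rw [show r - 1 - p = (r - 1) + (-p) by ring, Real.rpow_add ht0, mul_comm, mul_left_comm]
    refine mul_le_mul_of_nonneg_left ?_ (by positivity)
    rw [Real.rpow_neg ht0.le, ← div_eq_mul_inv, le_div_iff₀ (by positivity), mul_comm]
    exact htail t ht0
  rw [hsplit, lintegral_union measurableSet_Ioi (Ioc_disjoint_Ioi le_rfl)]
  calc _ ≤ ENNReal.ofReal r * (ENNReal.ofReal (1 / r) + ENNReal.ofReal (C / (p - r))) := by
        gcongr
    _ = _ := by
        rw [← ENNReal.ofReal_add (by positivity) (by positivity),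
          ← ENNReal.ofReal_mul (by linarith)]
        congr 1
        field_simp

end Probability

/-! ### The good-`λ` inequality. -/

section GoodLambda

variable {B : Type v} [NormedAddCommGroup B]
  [MeasurableSpace B] [BorelSpace B] {Ω : Type u} {mΩ : MeasurableSpace Ω} {μ : Measure Ω}

lemma measurable_sum_range_natural [SecondCountableTopology B] {X : ℕ → Ω → B}
    (hX : ∀ i, StronglyMeasurable (X i)) {k i : ℕ} (hk : k ≤ i + 1) :
    Measurable[Filtration.natural X hX i] fun ω => ∑ j ∈ Finset.range k, X j ω := by
  refine Finset.measurable_sum _ fun j hj => ?_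
  have hji : j ≤ i := by
    have := Finset.mem_range.mp hj
    omega
  exact ((Filtration.stronglyAdapted_natural hX j).mono
    ((Filtration.natural X hX).mono hji)).measurable

lemma measurableSet_isBetweenLevels [SecondCountableTopology B] {m : MeasurableSpace Ω}
    {X : ℕ → Ω → B} {i : ℕ} (l : ℝ)
    (hS : ∀ k ≤ i, Measurable[m] fun ω => ∑ j ∈ Finset.range k, X j ω) :
    MeasurableSet[m] {ω | IsBetweenLevels (fun j => X j ω) l i} := by
  have h1 : MeasurableSet[m] (⋃ k, ⋃ (_ : k ≤ i), {ω | l < ‖∑ j ∈ Finset.range k, X j ω‖}) :=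
    MeasurableSet.iUnion fun k => MeasurableSet.iUnion fun hk =>
      measurableSet_lt measurable_const (hS k hk).norm
  have h2 : MeasurableSet[m] (⋂ k, ⋂ (_ : k ≤ i), {ω | ‖∑ j ∈ Finset.range k, X j ω‖ ≤ 2 * l}) :=
    MeasurableSet.iInter fun k => MeasurableSet.iInter fun hk =>
      measurableSet_le (hS k hk).norm measurable_const
  convert h1.inter h2 using 1
  ext ω
  simp [IsBetweenLevels]

/-- Truncated increments have moments proportional to the probability that the level has been
exceeded. -/
lemma lintegral_betweenLevels_le [SecondCountableTopology B] [IsProbabilityMeasure μ]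
    {X : ℕ → Ω → B} (hX : ∀ i, StronglyMeasurable (X i)) (hindep : iIndepFun X μ)
    {r l : ℝ} (hr : 0 < r) (hl : 0 ≤ l) {i n : ℕ} (hi : i < n) :
    ∫⁻ ω, ‖{ω | IsBetweenLevels (fun j => X j ω) l i}.indicator (X i) ω‖ₑ ^ r ∂μ ≤
      (∫⁻ ω, ‖X i ω‖ₑ ^ r ∂μ) * μ {ω | ∃ k ≤ n, l < ‖∑ j ∈ Finset.range k, X j ω‖} := by
  set G := {ω | IsBetweenLevels (fun j => X j ω) l i} with hG
  -- No level is exceeded before the first increment. For later ones the selecting event involves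
  -- only earlier increments, hence is independent of the increment selected.
  rcases i with _ | i
  · have hG0 : G = ∅ := by
      ext ω
      simp only [hG, IsBetweenLevels, Set.mem_ofPred_eq, mem_empty_iff_false, iff_false]
      rintro ⟨⟨k, hk, h⟩, -⟩
      obtain rfl : k = 0 := by omega
      simp only [Finset.range_zero, Finset.sum_empty, norm_zero] at h
      linarith
    rw [hG0]
    simp [hr]
  have hGm : MeasurableSet[Filtration.natural X hX i] G :=
    measurableSet_isBetweenLevels l fun _ hk => measurable_sum_range_natural hX hk
  have h1 : ∀ ω, ‖G.indicator (X (i + 1)) ω‖ₑ ^ r =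
      ‖X (i + 1) ω‖ₑ ^ r * G.indicator (fun _ => 1) ω := by
    intro ω
    by_cases h : ω ∈ G <;> simp [h, hr]
  simp_rw [h1]
  rw [lintegral_mul_eq_lintegral_mul_lintegral_of_independent_measurableSpace
    (f := fun ω => ‖X (i + 1) ω‖ₑ ^ r)
    (hX (i + 1)).measurable.comap_le ((Filtration.natural X hX).le i)
    (hindep.indep_comap_natural_of_lt hX (Nat.lt_succ_self i))
    ((measurable_enorm.pow_const r).comp (comap_measurable (X (i + 1))))
    (measurable_const.indicator hGm),
    lintegral_indicator_const ((Filtration.natural X hX).le i _ hGm),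
    one_mul]
  gcongr
  rintro ω ⟨⟨k, hk, h⟩, -⟩
  exact ⟨k, by omega, h⟩

variable [NormedSpace ℝ B] [CompleteSpace B]

/-- The selection is predictable, so the indicator leaves the conditional expectation, and the
increment is centered given the past. -/
lemma isMartingaleDifference_betweenLevels [SecondCountableTopology B] [IsProbabilityMeasure μ]
    {X : ℕ → Ω → B} (hX : ∀ i, StronglyMeasurable (X i)) (hindep : iIndepFun X μ)
    (hint : ∀ i, Integrable (X i) μ) (hcentered : ∀ i, ∫ ω, X i ω ∂μ = 0) (l : ℝ) :
    IsMartingaleDifference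
      (fun i => {ω | IsBetweenLevels (fun j => X j ω) l i}.indicator (X i))
      (Filtration.natural X hX) μ where
  stronglyMeasurable i :=
    (Filtration.stronglyAdapted_natural hX i).indicator
      (measurableSet_isBetweenLevels l fun _ hk => measurable_sum_range_natural hX (by omega))
  integrable i := (hint i).indicator
    (measurableSet_isBetweenLevels l fun _ _ => Finset.measurable_sum _ fun j _ =>
      (hX j).measurable)
  condExp_eq_zero i := by
    refine (condExp_indicator (hint (i + 1)) (measurableSet_isBetweenLevels l
      fun _ hk => measurable_sum_range_natural hX hk)).trans ?_
    have h1 : μ[X (i + 1) | Filtration.natural X hX i] =ᵐ[μ] fun _ => ∫ ω, X (i + 1) ω ∂μ :=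
      condExp_indep_eq (hX (i + 1)).measurable.comap_le ((Filtration.natural X hX).le i)
        (comap_measurable (X (i + 1))).stronglyMeasurable
        (hindep.indep_comap_natural_of_lt hX (Nat.lt_succ_self i))
    filter_upwards [h1] with ω hω
    simp [hω, hcentered]

/-- The good-`λ` inequality for sums of independent centered variables. -/
lemma good_lambda [SecondCountableTopology B] [IsProbabilityMeasure μ] {r D w p C : ℝ}
    (hB : IsRDSmooth.{u, v} B r D) {X : ℕ → Ω → B} (hX : ∀ i, StronglyMeasurable (X i))
    (hindep : iIndepFun X μ) (hint : ∀ i, Integrable (X i) μ)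
    (hcentered : ∀ i, ∫ ω, X i ω ∂μ = 0) (hw : 0 ≤ w)
    (hmoment : ∀ i, ∫⁻ ω, ‖X i ω‖ₑ ^ r ∂μ ≤ ENNReal.ofReal w)
    (htail : ∀ i, ∀ t : ℝ, 0 < t → t ^ p * μ.real {ω | t < ‖X i ω‖} ≤ C) (n : ℕ) {l : ℝ}
    (hl : 0 < l) :
    μ.real {ω | ∃ k ≤ n, 2 * l < ‖∑ i ∈ Finset.range k, X i ω‖} ≤
      D * (n * w) * (l / 2) ^ (-r) *
        μ.real {ω | ∃ k ≤ n, l < ‖∑ i ∈ Finset.range k, X i ω‖} +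
      n * C * (l / 2) ^ (-p) := by
  classical
  obtain ⟨⟨hr, -, -⟩, hD, hsmooth⟩ := hB
  set E := {ω | ∃ k ≤ n, l < ‖∑ i ∈ Finset.range k, X i ω‖} with hE
  set Y : ℕ → Ω → B :=
    fun i => {ω | IsBetweenLevels (fun j => X j ω) l i}.indicator (X i) with hY
  have hl2 : 0 < l / 2 := by positivity
  have hsub : {ω | ∃ k ≤ n, 2 * l < ‖∑ i ∈ Finset.range k, X i ω‖} ⊆
      {ω | l / 2 < ‖∑ i ∈ Finset.range n, Y i ω‖} ∪
        ⋃ i ∈ Finset.range n, {ω | l / 2 < ‖X i ω‖} := by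
    intro ω hω
    by_cases hx : ∀ i < n, ‖X i ω‖ ≤ l / 2
    · left
      have := lt_norm_sum_betweenLevels hl hx hω
      simpa [hY, Set.indicator_apply] using this
    · right
      push Not at hx
      simpa using hx
  have hYsum : μ.real {ω | l / 2 < ‖∑ i ∈ Finset.range n, Y i ω‖} ≤
      D * (n * w) * (l / 2) ^ (-r) * μ.real E := by
    have h1 := hsmooth Ω mΩ μ inferInstance _ Y
      (isMartingaleDifference_betweenLevels hX hindep hint hcentered l) n
    have h2 : ∑ i ∈ Finset.range n, ∫⁻ ω, ‖Y i ω‖ₑ ^ r ∂μ ≤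
        ENNReal.ofReal (n * w * μ.real E) := by
      calc _ ≤ ∑ i ∈ Finset.range n, ENNReal.ofReal w * μ E :=
            Finset.sum_le_sum fun i hi =>
              (lintegral_betweenLevels_le hX hindep (by linarith) hl.le
                (Finset.mem_range.mp hi)).trans (by gcongr; exact hmoment i)
        _ = _ := by
            rw [Finset.sum_const, Finset.card_range, nsmul_eq_mul, ← ofReal_measureReal (s := E),
              ENNReal.ofReal_mul (by positivity), ENNReal.ofReal_mul (by positivity),
              ENNReal.ofReal_natCast, mul_assoc]
    -- Markov's inequality for the `r`-th power, then smoothness.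
    have h3 : ENNReal.ofReal ((l / 2) ^ r) * μ {ω | l / 2 < ‖∑ i ∈ Finset.range n, Y i ω‖} ≤
        ENNReal.ofReal (D * (n * w * μ.real E)) := by
      rw [ENNReal.ofReal_mul hD.le]
      calc _ ≤ ENNReal.ofReal ((l / 2) ^ r) *
            μ {ω | ENNReal.ofReal ((l / 2) ^ r) ≤ ‖∑ i ∈ Finset.range n, Y i ω‖ₑ ^ r} := by
            gcongr with ω
            intro h
            rw [← ofReal_norm, ENNReal.ofReal_rpow_of_nonneg (norm_nonneg _) (by linarith)]
            exact ENNReal.ofReal_le_ofReal (Real.rpow_le_rpow hl2.le h.le (by linarith))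
        _ ≤ ∫⁻ ω, ‖∑ i ∈ Finset.range n, Y i ω‖ₑ ^ r ∂μ := by
            refine mul_meas_ge_le_lintegral₀ ?_ _
            refine (Finset.aemeasurable_fun_sum _ fun i _ => ?_).enorm.pow_const r
            exact ((hX i).measurable.indicator (measurableSet_isBetweenLevels l fun _ _ =>
              Finset.measurable_sum _ fun j _ => (hX j).measurable)).aemeasurable
        _ ≤ _ := h1.trans (by gcongr)
    rw [← ofReal_measureReal, ← ENNReal.ofReal_mul (by positivity),
      ENNReal.ofReal_le_ofReal_iff (by positivity)] at h3
    rw [Real.rpow_neg hl2.le]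
    have h4 : 0 < (l / 2) ^ r := by positivity
    calc _ ≤ D * (n * w * μ.real E) / (l / 2) ^ r := by
          rw [le_div_iff₀ h4, mul_comm]; exact h3
      _ = _ := by ring
  have hXmax : μ.real (⋃ i ∈ Finset.range n, {ω | l / 2 < ‖X i ω‖}) ≤
      n * C * (l / 2) ^ (-p) := by
    refine (measureReal_biUnion_finset_le _ _).trans ?_
    calc _ ≤ ∑ i ∈ Finset.range n, C * (l / 2) ^ (-p) :=
          Finset.sum_le_sum fun i _ => by
            rw [Real.rpow_neg hl2.le, ← div_eq_mul_inv, le_div_iff₀ (by positivity), mul_comm]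
            exact htail i _ hl2
      _ = _ := by rw [Finset.sum_const, Finset.card_range, nsmul_eq_mul, mul_assoc]
  exact (measureReal_mono hsub).trans
    ((measureReal_union_le _ _).trans (add_le_add hYsum hXmax))

end GoodLambda
-- The deviation inequality.
theorem mainTheorem3 {B : Type v} [NormedAddCommGroup B] [NormedSpace ℝ B] [CompleteSpace B]
    [TopologicalSpace.SeparableSpace B] [MeasurableSpace B] [BorelSpace B]
    (r D p C : ℝ) (hB : IsRDSmooth.{u, v} B r D) (hp : r < p)
    {Ω : Type u} [MeasurableSpace Ω] (μ : Measure Ω) [IsProbabilityMeasure μ]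
    (X : ℕ → Ω → B) (hX : ∀ i, Measurable (X i)) (hindep : iIndepFun X μ)
    (hcentered : ∀ i, ∫ ω, X i ω ∂μ = 0)
    (htail : ∀ i, ∀ t : ℝ, 0 < t → t ^ p * μ.real {ω | t < ‖X i ω‖} ≤ C) :
    -- the moments of order `r` are finite, with a finite supremum
    (∀ i, Integrable (fun ω => ‖X i ω‖ ^ r) μ) ∧
    BddAbove (Set.range fun i => (∫ ω, ‖X i ω‖ ^ r ∂μ) ^ (secondExponent p r / r)) ∧
    -- the deviation inequality, with a constant for each of the two terms
    (∀ x : ℝ, 0 < x → ∀ n : ℕ, 1 ≤ n →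
      μ.real {ω | n * x < maxPartialSum X n ω} ≤
        (constTail p r D * (x ^ (-p) * C) +
          constMoment p r D * ((⨆ i, (∫ ω, ‖X i ω‖ ^ r ∂μ) ^ (secondExponent p r / r)) *
            x ^ (-secondExponent p r))) * (1 / (n : ℝ) ^ (p - 1))) ∧
    -- the same with a single constant
    (∀ x : ℝ, 0 < x → ∀ n : ℕ, 1 ≤ n →
      μ.real {ω | n * x < maxPartialSum X n ω} ≤
        max (constTail p r D) (constMoment p r D) *
          (x ^ (-p) * C + (⨆ i, (∫ ω, ‖X i ω‖ ^ r ∂μ) ^ (secondExponent p r / r)) *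
            x ^ (-secondExponent p r)) * (1 / (n : ℝ) ^ (p - 1))) ∧
    -- the rate
    (∀ x : ℝ, 0 < x →
      (fun n : ℕ => μ.real {ω | n * x < maxPartialSum X n ω}) =O[atTop]
        fun n : ℕ => 1 / (n : ℝ) ^ (p - 1)) := by
  have : SecondCountableTopology B := UniformSpace.secondCountable_of_separable B
  obtain ⟨⟨hr, hr2, -⟩, hD0, -⟩ := id hB
  set q := secondExponent p r with hq
  have hm := one_lt_secondExponent_div hr hp
  rw [← hq] at hm
  have hC : 0 ≤ C := le_trans (by positivity) (htail 0 1 one_pos)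
  have hpr : 0 < p - r := by linarith
  have hmom := fun i => lintegral_enorm_rpow_le_of_tail hr hp (hX i) (htail i)
  have henorm : ∀ i ω, ENNReal.ofReal (‖X i ω‖ ^ r) = ‖X i ω‖ₑ ^ r := fun i ω => by
    rw [← ofReal_norm, ENNReal.ofReal_rpow_of_nonneg (norm_nonneg _) (by linarith)]
  have hmeas : ∀ i, AEStronglyMeasurable (fun ω => ‖X i ω‖ ^ r) μ := fun i =>
    ((hX i).norm.pow_const r).aestronglyMeasurable
  have hnn : ∀ i ω, 0 ≤ ‖X i ω‖ ^ r := fun i ω => by positivity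
  have hintr : ∀ i, Integrable (fun ω => ‖X i ω‖ ^ r) μ := fun i => by
    refine ⟨hmeas i, ?_⟩
    rw [hasFiniteIntegral_iff_ofReal (Eventually.of_forall (hnn i))]
    simp_rw [henorm]
    exact (hmom i).trans_lt ENNReal.ofReal_lt_top
  have hE : ∀ i, ENNReal.ofReal (∫ ω, ‖X i ω‖ ^ r ∂μ) = ∫⁻ ω, ‖X i ω‖ₑ ^ r ∂μ := fun i => by
    rw [ofReal_integral_eq_lintegral_ofReal (hintr i) (Eventually.of_forall (hnn i))]
    simp_rw [henorm]
  have hE0 : ∀ i, 0 ≤ ∫ ω, ‖X i ω‖ ^ r ∂μ := fun i => integral_nonneg (hnn i)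
  have hbdd : BddAbove (Set.range fun i => (∫ ω, ‖X i ω‖ ^ r ∂μ) ^ (q / r)) := by
    refine ⟨(1 + r * C / (p - r)) ^ (q / r), ?_⟩
    rintro _ ⟨i, rfl⟩
    refine Real.rpow_le_rpow (hE0 i) ?_ (by linarith)
    rw [← ENNReal.ofReal_le_ofReal_iff (by positivity), hE]
    exact hmom i
  set M := ⨆ i, (∫ ω, ‖X i ω‖ ^ r ∂μ) ^ (q / r) with hM
  have hM0 : 0 ≤ M := (Real.rpow_nonneg (hE0 0) _).trans (le_ciSup hbdd 0)
  -- A uniform bound on the `r`-th moments, defined as a root of `M` so that `w ^ (q / r)` gives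
  -- back `M` exactly.
  set w := M ^ (q / r)⁻¹ with hw
  have hw0 : 0 ≤ w := Real.rpow_nonneg hM0 _
  have hwM : w ^ (q / r) = M := Real.rpow_inv_rpow hM0 (by linarith)
  have hEw : ∀ i, ∫⁻ ω, ‖X i ω‖ₑ ^ r ∂μ ≤ ENNReal.ofReal w := fun i => by
    rw [← hE]
    refine ENNReal.ofReal_le_ofReal ?_
    rw [← Real.rpow_le_rpow_iff (hE0 i) hw0 (by linarith : 0 < q / r), hwM]
    exact le_ciSup hbdd i
  have hint : ∀ i, Integrable (X i) μ := fun i => by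
    have hLr : MemLp (X i) (ENNReal.ofReal r) μ := by
      rw [← integrable_norm_rpow_iff (hX i).aestronglyMeasurable
        (by simpa using by linarith) ENNReal.ofReal_ne_top, ENNReal.toReal_ofReal (by linarith)]
      exact hintr i
    exact hLr.integrable (by rw [ENNReal.one_le_ofReal]; exact hr.le)
  have hq0 : 0 < q := by
    have h : q = q / r * r := by field_simp
    rw [h]
    nlinarith
  have hKt : 0 ≤ constTail p r D := by
    have := one_le_geometric_factor hq0
    unfold constTail
    simp only
    positivity
  have hKm : 0 ≤ constMoment p r D := by
    have := one_le_geometric_factor hq0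
    have h1 : 0 ≤ q - r := by
      rw [lt_div_iff₀ (by linarith)] at hm
      linarith
    unfold constMoment
    simp only
    positivity
  have hmain : ∀ x : ℝ, 0 < x → ∀ n : ℕ, 1 ≤ n →
      μ.real {ω | n * x < maxPartialSum X n ω} ≤
        (constTail p r D * (x ^ (-p) * C) +
          constMoment p r D * (M * x ^ (-q))) * (1 / (n : ℝ) ^ (p - 1)) := by
    intro x hx n hn
    have hn0 : (0 : ℝ) < n := by exact_mod_cast hn
    have hset : {ω | n * x < maxPartialSum X n ω} =
        {ω | ∃ k ≤ n, n * x < ‖∑ i ∈ Finset.range k, X i ω‖} := by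
      ext ω
      exact lt_maxPartialSum_iff X hn (by positivity) ω
    rw [hset]
    -- `1 ≤ D` is available only for nontrivial `B`; in the zero space the event is empty.
    rcases subsingleton_or_nontrivial B with hsub | hnt
    · have h0 : {ω | ∃ k ≤ n, n * x < ‖∑ i ∈ Finset.range k, X i ω‖} = ∅ := by
        ext ω
        have hnx : 0 < n * x := by positivity
        simp [Subsingleton.elim _ (0 : B), hnx.le]
      rw [h0, measureReal_empty]
      positivity
    · have h1 := le_of_good_lambda (W := n * w) (A := n * C) hr hr2 hp hB.one_le
        (by positivity) (by positivity)
        (f := fun y => μ.real {ω | ∃ k ≤ n, y < ‖∑ i ∈ Finset.range k, X i ω‖})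
        (fun y => measureReal_le_one) (fun y hy => by
          have := good_lambda hB (fun i => (hX i).stronglyMeasurable) hindep hint hcentered hw0
            hEw htail n (half_pos hy)
          rwa [show 2 * (y / 2) = y by ring, show y / 2 / 2 = y / 4 by ring] at this)
        (mul_pos hn0 hx)
      refine h1.trans_eq ?_
      rw [← hq, Real.mul_rpow hn0.le hw0, hwM, Real.mul_rpow hn0.le hx.le,
        Real.mul_rpow hn0.le hx.le]
      have e1 : (n : ℝ) * (n : ℝ) ^ (-p) = 1 / (n : ℝ) ^ (p - 1) := by
        nth_rewrite 1 [← Real.rpow_one (n : ℝ)]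
        rw [← Real.rpow_add hn0, one_div, ← Real.rpow_neg hn0.le]
        ring_nf
      -- The choice of `p₂` is exactly the solution of `q - q / r = p - 1`.
      have e2 : (n : ℝ) ^ (q / r) * (n : ℝ) ^ (-q) = 1 / (n : ℝ) ^ (p - 1) := by
        rw [← Real.rpow_add hn0, one_div, ← Real.rpow_neg hn0.le]
        congr 1
        have h2 : r - 1 ≠ 0 := by linarith
        rw [hq]
        unfold secondExponent
        field_simp
        ring
      rw [add_mul]
      nth_rewrite 1 [← e1]
      rw [← e2]
      ring
  refine ⟨hintr, hbdd, hmain, fun x hx n hn => (hmain x hx n hn).trans ?_, fun x hx => ?_⟩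
  · refine mul_le_mul_of_nonneg_right ?_ (by positivity)
    rw [mul_add]
    gcongr
    · exact le_max_left _ _
    · exact le_max_right _ _
  · refine Asymptotics.IsBigO.of_bound (constTail p r D * (x ^ (-p) * C) +
      constMoment p r D * (M * x ^ (-q))) ?_
    filter_upwards [eventually_ge_atTop 1] with n hn
    rw [Real.norm_of_nonneg measureReal_nonneg, Real.norm_of_nonneg (by positivity)]
    exact hmain x hx n hn
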